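/- Let $\mathcal A$ be a finite alphabet. A random substitution $\vartheta$ assigns to every letter $a\in\mathcal A$ a non-empty finite set $\vartheta(a)$ of non-empty words over $\mathcal A$; for a word $v=v_1\cdots v_\ell$ put $\vartheta(v)=\{t_1\cdots t_\ell : t_i\in\vartheta(v_i)\}$, and let $\vartheta^0(a)=\{a\}$, $\vartheta^{p+1}(a)=\bigcup_{w\in\vartheta^p(a)}\vartheta(w)$. A non-empty word is $\vartheta$-legal if it is a subword of some element of some $\vartheta^p(a)$, $a \in \mathcal A$, $p\ge 0$; $\mathcal L_\vartheta$ is the set of legal words. $\vartheta$ is non-degenerate if $\#\vartheta(a)\neq 1$ for some $a$; of constant length if all words in all $\vartheta(a)$ have the same length; primitive if for some $p\ge1$ and all letters $a,b$ the letter $a$ occurs in some word of $\vartheta^p(b)$; compatible if, for each $a$, all words in $\vartheta(a)$ contain each letter equally often; and has disjoint images of letters if $\vartheta(a)\cap\vartheta(b)\ne\varnothing$ implies $a=b$. An inflation word decomposition of a word $u$ is a pair $([u_1,\dots,u_\ell],v_1\cdots v_\ell)$ with $u_i$ non-empty, $u=u_1\cdots u_\ell$, root $v_1\cdots v_\ell\in\mathcal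 L_\vartheta$, such that for some words $l,r$ the words $lu_1,u_2,\dots,u_{\ell-1},u_\ell r$ (or $lu_1r$ if $\ell=1$) lie in $\vartheta(v_1),\dots,\vartheta(v_\ell)$, together with the offset $|l|$, i.e. the position of $u_1$ in its inflation word. A decomposition of a word restricts to an induced decomposition of each of its subwords (at a given position). A legal word $u$ is recognisable for $\vartheta$ if there is $N\ge 0$ such that for every legal word $w=u^{(l)}uu^{(r)}$ with $|u^{(l)}|=|u^{(r)}|=N$ all inflation word decompositions of $w$ induce the same decomposition of $u$. A word has a unique root with respect to $\vartheta$ if it has exactly one inflation word decomposition; its unique root is the root of that decomposition. Let $|w|_u$ be the number of (possibly overlapping) occurrences of $u$ in $w$. Lemma. Let $\vartheta$ be a non-degenerate, constant length, primitive, compatible random substitution with disjoint images of letters. If $\vartheta$ admits a recognisable word, then for some power $p\ge 1$, $\vartheta^p$ admits a recognisable word $u$ such that there is a strictly increasing sequence of lengths $(n_k)_{k\ge1}$ such that, for every $k\geq 1$, the set $$V_k=\{v : |v|=n_k,\ |uvu|_u=2,\ uvu\in\mathcal L_\vartheta\}$$ contains at least $k$ words $v$ that share a common unique root with respect to $\vartheta^p$,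 and for which also the words $uvu$ share a common unique root with respect to $\vartheta^p$. -/

import Mathlib

/-- A random substitution on the alphabet `A`: every letter is sent to a non-empty finite set of
non-empty words. -/
structure RandomSubst (A : Type*) where
  /-- the set `ϑ(a)` -/
  img : A → Set (List A)
  finite : ∀ a, (img a).Finite
  nonempty : ∀ a, (img a).Nonempty
  ne_nil : ∀ a, ∀ u ∈ img a, u ≠ []

namespace RandomSubst

variable {A : Type*}

/-- The set `ϑ(v)` of realisations of `ϑ` on a word `v = v₁ ⋯ v_ℓ`: all concatenations
`t₁ ⋯ t_ℓ` with `tᵢ ∈ ϑ(vᵢ)`. -/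
def onWord (ϑ : RandomSubst A) (v : List A) : Set (List A) :=
  {u | ∃ ts : List (List A), List.Forall₂ (fun a t => t ∈ ϑ.img a) v ts ∧ ts.flatten = u}

theorem onWord_finite (ϑ : RandomSubst A) (v : List A) : (ϑ.onWord v).Finite := by
  induction v with
  | nil =>
    refine (Set.finite_singleton ([] : List A)).subset ?_
    rintro u ⟨ts, h, rfl⟩
    cases h
    simp
  | cons a v ih =>
    refine (Set.Finite.image2 (fun s t => s ++ t) (ϑ.finite a) ih).subset ?_
    rintro u ⟨ts, h, rfl⟩
    cases h with
    | cons h1 h2 => exact ⟨_, h1, _, ⟨_, h2, rfl⟩, by simp⟩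

theorem onWord_nonempty (ϑ : RandomSubst A) (v : List A) : (ϑ.onWord v).Nonempty := by
  induction v with
  | nil => exact ⟨[], [], .nil, rfl⟩
  | cons a v ih =>
    obtain ⟨u, ts, h, rfl⟩ := ih
    obtain ⟨t, ht⟩ := ϑ.nonempty a
    exact ⟨_, t :: ts, .cons ht h, rfl⟩

theorem onWord_ne_nil (ϑ : RandomSubst A) {v u : List A} (hv : v ≠ []) (hu : u ∈ ϑ.onWord v) :
    u ≠ [] := by
  obtain ⟨ts, h, rfl⟩ := hu
  cases h with
  | nil => exact absurd rfl hv
  | cons h1 h2 => simp [ϑ.ne_nil _ _ h1]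

/-- The powers of `ϑ`: `ϑ⁰(a) = {a}` and `ϑ^{p+1}(a) = ⋃_{w ∈ ϑ^p(a)} ϑ(w)`. -/
def pow (ϑ : RandomSubst A) : ℕ → RandomSubst A
  | 0 =>
    { img := fun a => {[a]}
      finite := fun a => Set.finite_singleton _
      nonempty := fun a => Set.singleton_nonempty _
      ne_nil := by
        rintro a u rfl
        simp }
  | p + 1 =>
    { img := fun a => ⋃ w ∈ (pow ϑ p).img a, ϑ.onWord w
      finite := fun a => ((pow ϑ p).finite a).biUnion fun w _ => ϑ.onWord_finite w
      nonempty := fun a => by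
        obtain ⟨w, hw⟩ := (pow ϑ p).nonempty a
        obtain ⟨u, hu⟩ := ϑ.onWord_nonempty w
        exact ⟨u, Set.mem_biUnion hw hu⟩
      ne_nil := fun a u hu => by
        simp only [Set.mem_iUnion] at hu
        obtain ⟨w, hw, hu⟩ := hu
        exact ϑ.onWord_ne_nil ((pow ϑ p).ne_nil a w hw) hu }

/-- `u` is `ϑ`-legal, that is `u ∈ 𝓛_ϑ`: a non-empty word that is a subword of an element of
`ϑ^p(a)`, for some letter `a` and some `p ≥ 0`. -/
def Legal (ϑ : RandomSubst A) (u : List A) : Prop :=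
  u ≠ [] ∧ ∃ (a : A) (p : ℕ), ∃ w ∈ (ϑ.pow p).img a, u <:+: w

/-- `ϑ` is degenerate if every `ϑ(a)` consists of exactly one word. -/
def Degenerate (ϑ : RandomSubst A) : Prop :=
  ∀ a, (ϑ.img a).ncard = 1

/-- All inflation words have the same length. -/
def ConstantLength (ϑ : RandomSubst A) : Prop :=
  ∃ L : ℕ, ∀ a, ∀ u ∈ ϑ.img a, u.length = L

/-- Some power `p ≥ 1` is such that every letter `a` occurs in some word of `ϑ^p(b)`,
for every letter `b`. -/
def Primitive (ϑ : RandomSubst A) : Prop :=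
  ∃ p : ℕ, 1 ≤ p ∧ ∀ a b : A, ∃ w ∈ (ϑ.pow p).img b, a ∈ w

/-- All words in one `ϑ(a)` have the same abelianisation. -/
def Compatible [DecidableEq A] (ϑ : RandomSubst A) : Prop :=
  ∀ a, ∀ u ∈ ϑ.img a, ∀ v ∈ ϑ.img a, ∀ b : A, u.count b = v.count b

/-- `ϑ(a) ∩ ϑ(b) ≠ ∅` only if `a = b`. -/
def DisjointImages (ϑ : RandomSubst A) : Prop :=
  ∀ a b : A, (ϑ.img a ∩ ϑ.img b).Nonempty → a = b

end RandomSubst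

/-- The data of an inflation word decomposition `([u₁, …, u_ℓ], v₁ ⋯ v_ℓ)`: the list of the pairs
`(uᵢ, vᵢ)`, together with the number `offset` of letters of the first inflation word that lie to
the left of `u₁`, that is, the place at which `u₁` sits in that inflation word. -/
@[ext]
structure InflDecomp (A : Type*) where
  offset : ℕ
  tiles : List (List A × A)

namespace InflDecomp

variable {A : Type*}

/-- The cutting `[u₁, …, u_ℓ]`. -/
def cutting (d : InflDecomp A) : List (List A) := d.tiles.map Prod.fst

/-- The root `v₁ ⋯ v_ℓ`. -/
def root (d : InflDecomp A) : List A := d.tiles.map Prod.snd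

/-- Remove the first `i` letters from a sequence of tiles; a tile is dropped if no letter is
left of it. -/
def dropLetters : ℕ → List (List A × A) → List (List A × A)
  | _, [] => []
  | i, (p, a) :: ts =>
    if i < p.length then (p.drop i, a) :: ts else dropLetters (i - p.length) ts

/-- The offset of the first tile after the removal of the first `i` letters, where `s` is the
offset of the first tile before. Only the first tile can have a non-zero offset. -/
def dropOffset : ℕ → ℕ → List (List A × A) → ℕ
  | _, _, [] => 0
  | s, i, (p, _) :: ts => if i < p.length then s + i else dropOffset 0 (i - p.length) ts

/-- Keep only the first `m ≥ 1` letters of a sequence of tiles. -/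
def takeLetters : ℕ → List (List A × A) → List (List A × A)
  | _, [] => []
  | m, (p, a) :: ts =>
    if m ≤ p.length then [(p.take m, a)] else (p, a) :: takeLetters (m - p.length) ts

/-- The decomposition that `d` induces on the subword of `m ≥ 1` letters that starts after the
first `i` letters. -/
def induced (d : InflDecomp A) (i m : ℕ) : InflDecomp A where
  offset := dropOffset d.offset i d.tiles
  tiles := takeLetters m (dropLetters i d.tiles)

end InflDecomp

namespace RandomSubst

variable {A : Type*}

/-- `d ∈ D_ϑ(u)`: the pieces `u₁, …, u_ℓ` are non-empty and have the concatenation `u`, the root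
`v₁ ⋯ v_ℓ` is legal, and the pieces become inflation words of `v₁, …, v_ℓ` when a word `l` (of
length `d.offset`) is put before the first piece and a word `r` after the last piece. So `u₁` is a
suffix of an inflation word of `v₁`, `u_ℓ` is a prefix of one of `v_ℓ`, and `uᵢ ∈ ϑ(vᵢ)` otherwise;
for `ℓ = 1`, the word `u` is a subword of an inflation word of `v₁`. -/
def IsDecomp (ϑ : RandomSubst A) (u : List A) (d : InflDecomp A) : Prop :=
  ϑ.Legal d.root ∧ (∀ x ∈ d.cutting, x ≠ []) ∧ d.cutting.flatten = u ∧
    ∃ l r : List A, l.length = d.offset ∧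
      List.Forall₂ (fun a t => t ∈ ϑ.img a) d.root
        ((d.cutting.modifyHead (fun x => l ++ x)).modifyLast (fun x => x ++ r))

/-- `u` is a recognisable word of `ϑ`: it is legal and, for some `N`, for every legal word
`w = l u r` with `|l| = |r| = N`, all inflation word decompositions of `w` induce the same one
on `u`. -/
def RecognisableWord (ϑ : RandomSubst A) (u : List A) : Prop :=
  ϑ.Legal u ∧ ∃ N : ℕ, ∀ l r : List A, l.length = N → r.length = N → ϑ.Legal (l ++ u ++ r) →
    ∀ d d' : InflDecomp A, ϑ.IsDecomp (l ++ u ++ r) d → ϑ.IsDecomp (l ++ u ++ r) d' →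
      d.induced N u.length = d'.induced N u.length

/-- `w` has exactly one inflation word decomposition, and its root is `r`. -/
def HasUniqueRoot (ϑ : RandomSubst A) (w r : List A) : Prop :=
  ∃ d : InflDecomp A, ϑ.IsDecomp w d ∧ d.root = r ∧ ∀ d' : InflDecomp A, ϑ.IsDecomp w d' → d' = d

end RandomSubst

/-- `|w|_u`: the number of positions at which `u` occurs in `w` (occurrences may overlap). -/
def occurrences {A : Type*} [DecidableEq A] (u w : List A) : ℕ :=
  ((Finset.range (w.length + 1)).filter (fun i => u <+: w.drop i)).card

/-! A recognisable word, extended by its margins to a legal word z, fixes cutting points: in all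
realisations on legal words, z sits at the same place modulo L (`mod_eq_of_induced_eq`). For ϑ^p
this is too weak, since z only sees the last of the p steps. Therefore a word U ∈ ϑ^p(y) is built in
p steps, all of whose results contain z. If U occurs in a word of ϑ^p(R), R legal, the z of the last
step puts U at a multiple of L, disjoint images identify what lies above this occurrence with the
previous word of the chain, and the argument repeats. So U occurs only at multiples of L^p
(`ChainContaining.dvd_length`), and a realisation of ϑ^p on a legal word that contains U has a
unique root (`hasUniqueRoot_of_dvd`).

It remains to control the occurrences of u in uvu. The chain costs one letter of a legal word per
step, so |y| = p L^q with q independent of p, whereas #ϑ^p(b) grows doubly exponentially in p when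
#ϑ(b) ≥ 2 (`exists_pow_many_images`). For suitable p some t ∈ ϑ^p(b) is not a block of U, and two
further words t', t'' ∈ ϑ^p(b) are to spare. Let ψ be ϑ^p with t removed, and take u = tEU and v ∈
ψ(R), where E is a realisation of ψ and v contains U. Then u occurs in uvu at multiples of L^p only,
and the block t occurs only at the start of the two outer copies of u (`occurrences_eq_two`). To the
right of U, the root R has many letters b, each of which is realised freely as t' or t''; this
yields arbitrarily many v with one root. -/

namespace RandomSubst

variable {A : Type*} {ϑ : RandomSubst A} {L : ℕ}

/-! ### Realisations on words -/

theorem mem_onWord_nil {u : List A} : u ∈ ϑ.onWord [] ↔ u = [] := by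
  constructor
  · rintro ⟨ts, h, rfl⟩
    cases h
    rfl
  · rintro rfl
    exact ⟨[], .nil, rfl⟩

theorem mem_onWord_cons {a : A} {v u : List A} :
    u ∈ ϑ.onWord (a :: v) ↔ ∃ t ∈ ϑ.img a, ∃ s ∈ ϑ.onWord v, u = t ++ s := by
  constructor
  · rintro ⟨ts, h, rfl⟩
    cases h with
    | cons h1 h2 => exact ⟨_, h1, _, ⟨_, h2, rfl⟩, by simp⟩
  · rintro ⟨t, ht, s, ⟨ts, hs, rfl⟩, rfl⟩
    exact ⟨t :: ts, .cons ht hs, by simp⟩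

theorem mem_onWord_singleton {a : A} {u : List A} : u ∈ ϑ.onWord [a] ↔ u ∈ ϑ.img a := by
  simp [mem_onWord_cons, mem_onWord_nil]

theorem mem_onWord_append {v w u : List A} :
    u ∈ ϑ.onWord (v ++ w) ↔ ∃ s ∈ ϑ.onWord v, ∃ t ∈ ϑ.onWord w, u = s ++ t := by
  induction v generalizing u with
  | nil => simp [mem_onWord_nil]
  | cons a v ih =>
    simp only [List.cons_append, mem_onWord_cons, ih]
    constructor
    · rintro ⟨t, ht, _, ⟨s, hs, t', ht', rfl⟩, rfl⟩
      exact ⟨_, ⟨t, ht, s, hs, rfl⟩, t', ht', by simp⟩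
    · rintro ⟨_, ⟨t, ht, s, hs, rfl⟩, t', ht', rfl⟩
      exact ⟨t, ht, _, ⟨s, hs, t', ht', rfl⟩, by simp⟩

theorem append_mem_onWord {v w s t : List A} (hs : s ∈ ϑ.onWord v) (ht : t ∈ ϑ.onWord w) :
    s ++ t ∈ ϑ.onWord (v ++ w) :=
  mem_onWord_append.2 ⟨s, hs, t, ht, rfl⟩

theorem flatMap_mem_onWord {β : A → List A} (hβ : ∀ a, β a ∈ ϑ.img a) (v : List A) :
    v.flatMap β ∈ ϑ.onWord v := by
  induction v with
  | nil => simp [mem_onWord_nil]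
  | cons a v ih => exact mem_onWord_cons.2 ⟨_, hβ a, _, ih, by simp⟩

theorem length_of_mem_onWord (hL : ∀ a, ∀ u ∈ ϑ.img a, u.length = L) {v u : List A}
    (hu : u ∈ ϑ.onWord v) : u.length = v.length * L := by
  induction v generalizing u with
  | nil => simp [mem_onWord_nil.1 hu]
  | cons a v ih =>
    obtain ⟨t, ht, s, hs, rfl⟩ := mem_onWord_cons.1 hu
    simp [hL a t ht, ih hs]
    ring

theorem onWord_split (hL : ∀ a, ∀ u ∈ ϑ.img a, u.length = L) (hpos : 0 < L)
    {R s t : List A} {k : ℕ} (h : s ++ t ∈ ϑ.onWord R) (hs : s.length = k * L) :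
    s ∈ ϑ.onWord (R.take k) ∧ t ∈ ϑ.onWord (R.drop k) := by
  have hl := length_of_mem_onWord hL h
  have hk : k ≤ R.length := by
    rw [List.length_append, hs] at hl
    exact Nat.le_of_mul_le_mul_right (by omega) hpos
  rw [← List.take_append_drop k R] at h
  obtain ⟨s', hs', t', ht', e⟩ := mem_onWord_append.1 h
  have := length_of_mem_onWord hL hs'
  rw [List.length_take, min_eq_left hk] at this
  obtain ⟨rfl, rfl⟩ := List.append_inj e (by omega)
  exact ⟨hs', ht'⟩

/-- Constant length cuts `u` at the same places for both roots; disjoint images then identify the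
letters one by one. -/
theorem onWord_injective (hL : ∀ a, ∀ u ∈ ϑ.img a, u.length = L)
    (hd : ϑ.DisjointImages) {v w u : List A} (hv : u ∈ ϑ.onWord v) (hw : u ∈ ϑ.onWord w) :
    v = w := by
  induction v generalizing w u with
  | nil =>
    cases w with
    | nil => rfl
    | cons b w => exact absurd (mem_onWord_nil.1 hv) (ϑ.onWord_ne_nil (by simp) hw)
  | cons a v ih =>
    cases w with
    | nil => exact absurd (mem_onWord_nil.1 hw) (ϑ.onWord_ne_nil (by simp) hv)
    | cons b w =>
      obtain ⟨t, ht, s, hs, rfl⟩ := mem_onWord_cons.1 hv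
      obtain ⟨t', ht', s', hs', e⟩ := mem_onWord_cons.1 hw
      obtain ⟨rfl, rfl⟩ := List.append_inj e (by rw [hL _ _ ht, hL _ _ ht'])
      rw [hd a b ⟨t, ht, ht'⟩, ih hs hs']

/-! ### Powers -/

theorem mem_pow_zero_img {a : A} {u : List A} : u ∈ (ϑ.pow 0).img a ↔ u = [a] :=
  Iff.rfl

theorem mem_pow_succ_img {p : ℕ} {a : A} {u : List A} :
    u ∈ (ϑ.pow (p + 1)).img a ↔ ∃ w ∈ (ϑ.pow p).img a, u ∈ ϑ.onWord w := by
  simp [pow]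

theorem mem_onWord_pow_zero {v u : List A} : u ∈ (ϑ.pow 0).onWord v ↔ u = v := by
  induction v generalizing u with
  | nil => simp [mem_onWord_nil]
  | cons a v ih => simp [mem_onWord_cons, ih, mem_pow_zero_img]

theorem mem_onWord_pow_succ {p : ℕ} {v u : List A} :
    u ∈ (ϑ.pow (p + 1)).onWord v ↔ ∃ w ∈ (ϑ.pow p).onWord v, u ∈ ϑ.onWord w := by
  induction v generalizing u with
  | nil => simp [mem_onWord_nil]
  | cons a v ih =>
    simp only [mem_onWord_cons, ih, mem_pow_succ_img]
    constructor
    · rintro ⟨t, ⟨w, hw, ht⟩, s, ⟨w', hw', hs⟩, rfl⟩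
      exact ⟨w ++ w', ⟨w, hw, w', hw', rfl⟩, append_mem_onWord ht hs⟩
    · rintro ⟨_, ⟨w, hw, w', hw', rfl⟩, h⟩
      obtain ⟨t, ht, s, hs, rfl⟩ := mem_onWord_append.1 h
      exact ⟨t, ⟨w, hw, ht⟩, s, ⟨w', hw', hs⟩, rfl⟩

theorem mem_onWord_pow_add {p q : ℕ} {v u : List A} :
    u ∈ (ϑ.pow (p + q)).onWord v ↔ ∃ w ∈ (ϑ.pow p).onWord v, u ∈ (ϑ.pow q).onWord w := by
  induction q generalizing u with
  | zero => simp [mem_onWord_pow_zero]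
  | succ q ih =>
    rw [← add_assoc, mem_onWord_pow_succ]
    simp only [ih, mem_onWord_pow_succ]
    constructor
    · rintro ⟨x, ⟨w, hw, hx⟩, hu⟩
      exact ⟨w, hw, x, hx, hu⟩
    · rintro ⟨w, hw, x, hx, hu⟩
      exact ⟨x, ⟨w, hw, hx⟩, hu⟩

theorem mem_onWord_pow_one {v u : List A} : u ∈ (ϑ.pow 1).onWord v ↔ u ∈ ϑ.onWord v := by
  simp [mem_onWord_pow_succ, mem_onWord_pow_zero]

theorem mem_onWord_pow_pow {p n : ℕ} {v u : List A} :
    u ∈ ((ϑ.pow p).pow n).onWord v ↔ u ∈ (ϑ.pow (p * n)).onWord v := by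
  induction n generalizing u with
  | zero => simp [mem_onWord_pow_zero]
  | succ n ih => simp only [mem_onWord_pow_succ, Nat.mul_succ, mem_onWord_pow_add, ih]

theorem mem_pow_add_img {p q : ℕ} {a : A} {u : List A} :
    u ∈ (ϑ.pow (p + q)).img a ↔ ∃ w ∈ (ϑ.pow p).img a, u ∈ (ϑ.pow q).onWord w := by
  simp only [← mem_onWord_singleton, mem_onWord_pow_add]

theorem length_of_mem_pow_img (hL : ∀ a, ∀ u ∈ ϑ.img a, u.length = L) (p : ℕ) :
    ∀ a, ∀ u ∈ (ϑ.pow p).img a, u.length = L ^ p := by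
  induction p with
  | zero => simp [pow]
  | succ p ih =>
    intro a u hu
    obtain ⟨w, hw, hu⟩ := mem_pow_succ_img.1 hu
    rw [length_of_mem_onWord hL hu, ih a w hw, pow_succ]

theorem DisjointImages.pow (hL : ∀ a, ∀ u ∈ ϑ.img a, u.length = L)
    (hd : ϑ.DisjointImages) (p : ℕ) : (ϑ.pow p).DisjointImages := by
  induction p with
  | zero =>
    rintro a b ⟨u, hu, hu'⟩
    simp only [RandomSubst.pow, Set.mem_singleton_iff] at hu hu'
    simpa [hu] using hu'
  | succ p ih =>
    rintro a b ⟨u, hu, hu'⟩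
    obtain ⟨w, hw, hu⟩ := mem_pow_succ_img.1 hu
    obtain ⟨w', hw', hu'⟩ := mem_pow_succ_img.1 hu'
    obtain rfl := onWord_injective hL hd hu hu'
    exact ih a b ⟨w, hw, hw'⟩

/-! ### Legal words -/

theorem Legal.infix {u v : List A} (h : ϑ.Legal u) (hv : v ≠ []) (hvu : v <:+: u) :
    ϑ.Legal v := by
  obtain ⟨_, a, p, w, hw, huw⟩ := h
  exact ⟨hv, a, p, w, hw, hvu.trans huw⟩

theorem exists_infix_onWord {u w : List A} (h : u <:+: w) {x : List A} (hx : x ∈ ϑ.onWord u) :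
    ∃ y ∈ ϑ.onWord w, x <:+: y := by
  obtain ⟨l, r, rfl⟩ := h
  obtain ⟨l', hl'⟩ := ϑ.onWord_nonempty l
  obtain ⟨r', hr'⟩ := ϑ.onWord_nonempty r
  exact ⟨_, append_mem_onWord (append_mem_onWord hl' hx) hr', l', r', rfl⟩

theorem Legal.onWord_pow {u : List A} (h : ϑ.Legal u) {p : ℕ} {v : List A}
    (hv : v ∈ (ϑ.pow p).onWord u) : ϑ.Legal v := by
  obtain ⟨hu, a, q, w, hw, huw⟩ := h
  obtain ⟨y, hy, hvy⟩ := exists_infix_onWord huw hv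
  exact ⟨(ϑ.pow p).onWord_ne_nil hu hv, a, q + p, y, mem_pow_add_img.2 ⟨w, hw, hy⟩, hvy⟩

theorem Legal.onWord {u : List A} (h : ϑ.Legal u) {v : List A} (hv : v ∈ ϑ.onWord u) :
    ϑ.Legal v :=
  h.onWord_pow (mem_onWord_pow_one.2 hv)

theorem Legal.of_pow {p : ℕ} {u : List A} (h : (ϑ.pow p).Legal u) : ϑ.Legal u := by
  obtain ⟨hu, a, n, w, hw, huw⟩ := h
  rw [← mem_onWord_singleton, mem_onWord_pow_pow, mem_onWord_singleton] at hw
  exact ⟨hu, a, _, w, hw, huw⟩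

/-- Every legal word occurs in realisations of all large powers on every letter. -/
theorem Primitive.exists_infix (hprim : ϑ.Primitive) {u : List A} (hu : ϑ.Legal u) :
    ∃ s₀, ∀ s, s₀ ≤ s → ∀ b, ∃ w ∈ (ϑ.pow s).img b, u <:+: w := by
  obtain ⟨p, -, hp⟩ := hprim
  obtain ⟨-, a, q, w, hw, huw⟩ := hu
  refine ⟨p + q, fun s hs b => ?_⟩
  obtain ⟨x, hx⟩ := (ϑ.pow (s - (p + q))).nonempty b
  obtain ⟨c, x', rfl⟩ := List.exists_cons_of_ne_nil ((ϑ.pow (s - (p + q))).ne_nil b x hx)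
  obtain ⟨y, hy, hay⟩ := hp a c
  have hay' : [a] <:+: y := by
    obtain ⟨l, r, rfl⟩ := List.append_of_mem hay
    exact ⟨l, r, by simp⟩
  obtain ⟨y', hy', hyy'⟩ := exists_infix_onWord (w := c :: x')
    (show [c] <:+: c :: x' from ⟨[], x', rfl⟩) (mem_onWord_singleton.2 hy)
  obtain ⟨z, hz, hwz⟩ := exists_infix_onWord (hay'.trans hyy') (mem_onWord_singleton.2 hw)
  have es : s = s - (p + q) + p + q := by omega
  rw [es]
  exact ⟨z, mem_pow_add_img.2 ⟨y', mem_pow_add_img.2 ⟨_, hx, hy'⟩, hz⟩, huw.trans hwz⟩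

/-- By primitivity the exponent may be any large number, in particular a multiple of `p`. -/
theorem Legal.pow (hprim : ϑ.Primitive) {u : List A} (hu : ϑ.Legal u) {p : ℕ} (hp : 1 ≤ p) :
    (ϑ.pow p).Legal u := by
  obtain ⟨s₀, hs⟩ := hprim.exists_infix hu
  obtain ⟨h, a, -⟩ := hu
  obtain ⟨w, hw, huw⟩ := hs (p * s₀) (Nat.le_mul_of_pos_left _ hp) a
  refine ⟨h, a, s₀, w, ?_, huw⟩
  rwa [← mem_onWord_singleton, mem_onWord_pow_pow, mem_onWord_singleton]

theorem exists_legal_length (hL : ∀ a, ∀ u ∈ ϑ.img a, u.length = L) (h2 : 2 ≤ L) (a : A)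
    {n : ℕ} (hn : 1 ≤ n) : ∃ u, ϑ.Legal u ∧ u.length = n := by
  obtain ⟨w, hw⟩ := (ϑ.pow n).nonempty a
  have hl := length_of_mem_pow_img hL n a w hw
  have : n < L ^ n := Nat.lt_pow_self (by omega)
  have hlen : (w.take n).length = n := by rw [List.length_take]; omega
  refine ⟨w.take n, ⟨?_, a, n, w, hw, (List.take_prefix n w).isInfix⟩, hlen⟩
  intro h
  rw [h] at hlen
  simp at hlen
  omega

end RandomSubst

namespace RandomSubst

variable {A : Type*} {ϑ : RandomSubst A} {L : ℕ}

/-! ### Inflation word decompositions for constant length -/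

theorem flatten_modifyHead_append (l : List A) {xs : List (List A)} (h : xs ≠ []) :
    (xs.modifyHead (fun x => l ++ x)).flatten = l ++ xs.flatten := by
  cases xs with
  | nil => exact absurd rfl h
  | cons x xs => simp

theorem flatten_modifyLast_append (r : List A) {xs : List (List A)} (h : xs ≠ []) :
    (xs.modifyLast (fun x => x ++ r)).flatten = xs.flatten ++ r := by
  obtain ⟨ys, y, rfl⟩ := List.eq_nil_or_concat xs |>.resolve_left h
  simp [List.modifyLast_concat]

theorem modifyLast_singleton (f : List A → List A) (x : List A) :
    [x].modifyLast f = [f x] :=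
  List.modifyLast_concat f x []

theorem eq_of_flatten_eq (hL : ∀ a, ∀ u ∈ ϑ.img a, u.length = L) {R : List A}
    {c c' : List (List A)} (hc : List.Forall₂ (fun a t => t ∈ ϑ.img a) R c)
    (hc' : List.Forall₂ (fun a t => t ∈ ϑ.img a) R c') (e : c.flatten = c'.flatten) :
    c = c' := by
  induction hc generalizing c' with
  | nil =>
    cases hc'
    rfl
  | cons ha _ ih =>
    cases hc' with
    | cons ha' h =>
      simp only [List.flatten_cons] at e
      obtain ⟨e1, e2⟩ := List.append_inj e (by rw [hL _ _ ha, hL _ _ ha'])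
      rw [e1, ih h e2]

theorem IsDecomp.tiles_ne_nil {u : List A} {d : InflDecomp A} (h : ϑ.IsDecomp u d) :
    d.tiles ≠ [] := by
  intro e
  exact h.1.1 (by simp [InflDecomp.root, e])

theorem IsDecomp.exists_onWord {u : List A} {d : InflDecomp A} (h : ϑ.IsDecomp u d) :
    ∃ l r : List A, l.length = d.offset ∧ l ++ u ++ r ∈ ϑ.onWord d.root := by
  have hne := h.tiles_ne_nil
  obtain ⟨-, -, rfl, l, r, hl, hf⟩ := h
  refine ⟨l, r, hl, _, hf, ?_⟩
  have h1 : d.cutting ≠ [] := by simpa [InflDecomp.cutting] using hne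
  rw [flatten_modifyLast_append, flatten_modifyHead_append _ h1]
  intro h
  apply h1
  cases hc : d.cutting with
  | nil => rfl
  | cons x xs => simp [hc] at h

/-- Passing the first tile lowers `l.length + i` by exactly `L`, since `l` and that tile make up a
full inflation word; the later tiles start with offset `0`. -/
theorem dropOffset_eq_mod {l r : List A} {ts : List (List A × A)} {i : ℕ}
    (hlen : ∀ t ∈ ((ts.map Prod.fst).modifyHead (fun x => l ++ x)).modifyLast (fun x => x ++ r),
      t.length = L)
    (hne : ∀ x ∈ ts.map Prod.fst, x ≠ [])
    (hi : i < (ts.map Prod.fst).flatten.length) :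
    InflDecomp.dropOffset l.length i ts = (l.length + i) % L := by
  induction ts generalizing l i with
  | nil => simp at hi
  | cons t ts ih =>
    obtain ⟨p, a⟩ := t
    cases ts with
    | nil =>
      simp only [List.map_cons, List.map_nil, List.flatten_cons, List.flatten_nil,
        List.append_nil] at hi
      have := hlen (l ++ p ++ r) (by
        simp [modifyLast_singleton])
      simp only [List.length_append] at this
      rw [InflDecomp.dropOffset, if_pos hi, Nat.mod_eq_of_lt (by omega)]
    | cons t' ts =>
      obtain ⟨q, b⟩ := t'
      have e : (((p, a) :: (q, b) :: ts).map Prod.fst |>.modifyHead (fun x => l ++ x)).modifyLast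
          (fun x => x ++ r) = (l ++ p) :: (((q, b) :: ts).map Prod.fst |>.modifyHead
            (fun x => [] ++ x)).modifyLast (fun x => x ++ r) := by
        have := List.modifyLast_append_of_right_ne_nil (fun x => x ++ r) [l ++ p]
          (q :: ts.map Prod.fst) (by simp)
        simpa using this
      rw [e] at hlen
      have hp := hlen (l ++ p) (by simp)
      have hp0 : 0 < p.length := List.length_pos_iff.2 (hne p (by simp))
      rw [List.length_append] at hp
      rw [InflDecomp.dropOffset]
      split_ifs with hip
      · rw [Nat.mod_eq_of_lt (by omega)]
      · have := ih (l := []) (i := i - p.length)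
          (fun t ht => hlen t (List.mem_cons_of_mem _ ht))
          (fun x hx => hne x (List.mem_cons_of_mem _ hx)) (by
            rw [List.map_cons, List.flatten_cons, List.length_append] at hi
            simp only at hi
            omega)
        rw [List.length_nil, Nat.zero_add] at this
        rw [this, show l.length + i = (i - p.length) + L by omega, Nat.add_mod_right]

theorem IsDecomp.induced_offset (hL : ∀ a, ∀ u ∈ ϑ.img a, u.length = L) {u : List A}
    {d : InflDecomp A} (h : ϑ.IsDecomp u d) {i m : ℕ} (hi : i < u.length) :
    (d.induced i m).offset = (d.offset + i) % L := by
  obtain ⟨-, hne, rfl, l, r, hl, hf⟩ := h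
  rw [← hl]
  simp only [InflDecomp.induced]
  rw [← hl]
  refine dropOffset_eq_mod (r := r) (fun t ht => ?_) hne hi
  obtain ⟨j, hj, rfl⟩ := List.getElem_of_mem ht
  have hj' := hf.length_eq ▸ hj
  exact hL _ _ (hf.get hj' hj)

/-- A realisation on a legal word, cut down at both ends within the outer inflation words, gives
an inflation word decomposition. -/
theorem exists_isDecomp (hL : ∀ a, ∀ u ∈ ϑ.img a, u.length = L) {R l u r : List A}
    (hR : ϑ.Legal R) (h : l ++ u ++ r ∈ ϑ.onWord R) (hu : u ≠ [])
    (hl : l.length < L) (hr : r.length < L) :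
    ∃ d, ϑ.IsDecomp u d ∧ d.offset = l.length ∧ d.root = R := by
  obtain ⟨ts, hf, e⟩ := h
  cases hf with
  | nil => simp [hu] at e
  | @cons a t R ts hat hf =>
    rcases List.eq_nil_or_concat ts with rfl | ⟨ts, t', rfl⟩
    · cases hf
      simp only [List.flatten_cons, List.flatten_nil, List.append_nil] at e
      subst e
      refine ⟨⟨l.length, [(u, a)]⟩, ⟨hR, by simpa [InflDecomp.cutting] using hu,
        by simp [InflDecomp.cutting], l, r, rfl, ?_⟩, rfl, by simp [InflDecomp.root]⟩
      simpa [InflDecomp.root, InflDecomp.cutting, modifyLast_singleton] using hat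
    · obtain ⟨R', a', rfl⟩ : ∃ R' a', R = R' ++ [a'] := by
        rcases List.eq_nil_or_concat R with rfl | ⟨R', a', rfl⟩
        · simpa using hf.length_eq
        · exact ⟨R', a', by simp⟩
      have hf' := hf
      rw [List.concat_eq_append] at hf
      have hlen : R'.length = ts.length := by simpa using hf.length_eq
      have h1 : List.Forall₂ (fun a t => t ∈ ϑ.img a) R' ts := by
        have := List.forall₂_take_append _ _ _ hf
        rwa [← hlen, List.take_left'] at this
        rfl
      have h2 : t' ∈ ϑ.img a' := by
        have := List.forall₂_drop_append _ _ _ hf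
        rw [← hlen, List.drop_left'] at this
        · simpa using this
        · rfl
      have lt := hL _ _ hat
      have lt' := hL _ _ h2
      simp only [List.concat_eq_append, List.flatten_cons, List.flatten_append, List.flatten_nil,
        List.append_nil] at e
      obtain ⟨x, rfl⟩ : ∃ x, t = l ++ x := by
        have h1 : l <+: t ++ (ts.flatten ++ t') := by rw [e]; simp
        have h2 := List.prefix_of_prefix_length_le h1 (List.prefix_append t _) (by omega)
        exact ⟨_, h2.choose_spec.symm⟩
      obtain ⟨y, rfl⟩ : ∃ y, t' = y ++ r := by
        have h1 : r <:+ (l ++ x ++ ts.flatten) ++ t' := by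
          rw [List.append_assoc, e]; exact List.suffix_append _ _
        have h2 := List.suffix_of_suffix_length_le h1 (List.suffix_append _ t') (by omega)
        exact ⟨_, h2.choose_spec.symm⟩
      have eu : u = x ++ (ts.flatten ++ y) := by
        have : l ++ (x ++ (ts.flatten ++ y)) ++ r = l ++ u ++ r := by
          rw [← e]; simp
        exact (List.append_cancel_left (List.append_cancel_right this)).symm
      simp only [List.length_append] at lt lt'
      refine ⟨⟨l.length, (x, a) :: (ts.zip R' ++ [(y, a')])⟩,
        ⟨by simpa [InflDecomp.root, List.map_snd_zip, hlen] using hR, ?_, ?_, l, r, rfl, ?_⟩, rfl,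
          by simp [InflDecomp.root, List.map_snd_zip, hlen]⟩
      · have hx : x ≠ [] := by rintro rfl; simp at lt; omega
        have hy : y ≠ [] := by rintro rfl; simp at lt'; omega
        simp only [InflDecomp.cutting, List.map_cons, List.map_append, List.map_nil,
          List.map_fst_zip hlen.ge, List.mem_cons, List.mem_append, List.not_mem_nil, or_false]
        rintro z (rfl | hz | rfl)
        · exact hx
        · obtain ⟨j, hj, rfl⟩ := List.getElem_of_mem hz
          exact ϑ.ne_nil _ _ (h1.get (hlen ▸ hj) hj)
        · exact hy
      · simp [InflDecomp.cutting, List.map_fst_zip hlen.ge, eu]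
      · have := List.modifyLast_concat (fun x => x ++ r) y ((l ++ x) :: ts)
        simp only [InflDecomp.cutting, InflDecomp.root, List.map_cons, List.map_append,
          List.map_nil, List.map_fst_zip hlen.ge, List.map_snd_zip hlen.le,
          List.modifyHead_cons]
        rw [show (l ++ x) :: (ts ++ [y]) = (l ++ x) :: ts ++ [y] from rfl, this]
        exact .cons hat (by simpa using hf')

/-- Whole inflation words are cut off on both sides of `u`. This prepares for `exists_isDecomp` and
keeps the position of `u` modulo `L`. -/
theorem exists_trimmed_onWord (hL : ∀ a, ∀ u ∈ ϑ.img a, u.length = L) (hpos : 0 < L)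
    {R l u r : List A} (hR : ϑ.Legal R) (h : l ++ u ++ r ∈ ϑ.onWord R) (hu : u ≠ []) :
    ∃ R' l' r', ϑ.Legal R' ∧ l' ++ u ++ r' ∈ ϑ.onWord R' ∧ l'.length = l.length % L ∧
      r'.length < L := by
  have hlen := length_of_mem_onWord hL h
  simp only [List.length_append] at hlen
  set k := l.length / L with hk
  have hk' : k * L + l.length % L = l.length := Nat.div_add_mod' _ _
  set j := r.length / L with hj
  have hj' : j * L + r.length % L = r.length := Nat.div_add_mod' _ _
  have hm := Nat.mod_lt r.length hpos
  have hle : k + j ≤ R.length := by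
    by_contra hc
    have : R.length * L + L ≤ (k + j) * L := by
      rw [← Nat.succ_mul]; exact Nat.mul_le_mul_right _ (by omega)
    have hu' := List.length_pos_iff.2 hu
    rw [add_mul] at this
    linarith [Nat.zero_le (l.length % L), Nat.zero_le (r.length % L)]
  have e1 : l = l.take (k * L) ++ l.drop (k * L) := (List.take_append_drop _ _).symm
  have h1 := (onWord_split (s := l.take (k * L)) (t := l.drop (k * L) ++ u ++ r) (k := k) hL hpos
    (by rw [← List.append_assoc, ← List.append_assoc, ← e1]; exact h)
    (by rw [List.length_take]; omega)).2
  have e2 : r = r.take (r.length % L) ++ r.drop (r.length % L) :=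
    (List.take_append_drop _ _).symm
  have e3 : (R.length - k - j) * L + k * L + j * L = R.length * L := by
    rw [← add_mul, ← add_mul]; congr 1; omega
  have h2 := (onWord_split (s := l.drop (k * L) ++ u ++ r.take (r.length % L))
    (t := r.drop (r.length % L)) (k := R.length - k - j) hL hpos
    (by rw [List.append_assoc _ (r.take _), ← e2]; exact h1)
    (by simp only [List.length_append, List.length_take, List.length_drop]; omega)).1
  refine ⟨_, _, _, ?_, h2, by rw [List.length_drop]; omega, by
    rw [List.length_take]; omega⟩
  refine hR.infix ?_ ((List.take_prefix _ _).isInfix.trans (List.drop_suffix _ _).isInfix)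
  intro e
  rw [e, mem_onWord_nil] at h2
  simp [hu] at h2

/-- If every decomposition induces the same offset on `z`, then the places at which `z` occurs
in a realisation on a legal word agree modulo the length of the inflation words. -/
theorem mod_eq_of_induced_eq (hL : ∀ a, ∀ u ∈ ϑ.img a, u.length = L) (hpos : 0 < L)
    {z : List A} {N m : ℕ} (hN : N < z.length)
    (hz : ∀ d d' : InflDecomp A, ϑ.IsDecomp z d → ϑ.IsDecomp z d' →
      d.induced N m = d'.induced N m)
    {R R' l l' r r' : List A} (hR : ϑ.Legal R) (hR' : ϑ.Legal R')
    (h : l ++ z ++ r ∈ ϑ.onWord R) (h' : l' ++ z ++ r' ∈ ϑ.onWord R') :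
    l.length % L = l'.length % L := by
  have hne : z ≠ [] := by rintro rfl; simp at hN
  obtain ⟨S, s, t, hS, hs, hsl, htl⟩ := exists_trimmed_onWord hL hpos hR h hne
  obtain ⟨S', s', t', hS', hs', hsl', htl'⟩ := exists_trimmed_onWord hL hpos hR' h' hne
  obtain ⟨d, hd, hdo, -⟩ := exists_isDecomp hL hS hs hne
    (hsl ▸ Nat.mod_lt _ hpos) htl
  obtain ⟨d', hd', hdo', -⟩ := exists_isDecomp hL hS' hs' hne
    (hsl' ▸ Nat.mod_lt _ hpos) htl'
  -- Of the two induced decompositions only the offsets are compared: they are the positions of `z`,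
  -- shifted by `N` and reduced modulo `L`.
  have e := congrArg InflDecomp.offset (hz d d' hd hd')
  rw [hd.induced_offset hL hN, hd'.induced_offset hL hN, hdo, hdo', hsl, hsl'] at e
  have := Nat.ModEq.add_right_cancel' N e
  simpa [Nat.ModEq] using this

/-- A realisation on a legal word has a unique root if all its decompositions have offset `0`
modulo the length of the inflation words. -/
theorem hasUniqueRoot_of_dvd (hL : ∀ a, ∀ u ∈ ϑ.img a, u.length = L) (hpos : 0 < L)
    (hd : ϑ.DisjointImages) {R w : List A} (hR : ϑ.Legal R) (hw : w ∈ ϑ.onWord R)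
    (h : ∀ R' l r, ϑ.Legal R' → l ++ w ++ r ∈ ϑ.onWord R' → L ∣ l.length) :
    ϑ.HasUniqueRoot w R := by
  have hne : w ≠ [] := ϑ.onWord_ne_nil hR.1 hw
  have hwl := length_of_mem_onWord hL hw
  have key : ∀ d, ϑ.IsDecomp w d → d.offset = 0 ∧
      List.Forall₂ (fun a t => t ∈ ϑ.img a) d.root d.cutting ∧ d.cutting.flatten = w := by
    intro d hd
    obtain ⟨l', r', hl', hm'⟩ := hd.exists_onWord
    have hdvd := h _ _ _ hd.1 hm'
    have htne := hd.tiles_ne_nil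
    obtain ⟨-, hcne, hcf, l, r, hl, hf⟩ := hd
    have h1 : d.cutting ≠ [] := by simpa [InflDecomp.cutting] using htne
    have hh : (d.cutting.modifyHead (fun x => l ++ x)) ≠ [] := by
      cases hc : d.cutting <;> simp_all
    have hm : l ++ w ++ r ∈ ϑ.onWord d.root := by
      refine ⟨_, hf, ?_⟩
      rw [flatten_modifyLast_append _ hh, flatten_modifyHead_append _ h1, hcf]
    have hlen : ∀ t ∈ (d.cutting.modifyHead (fun x => l ++ x)).modifyLast (fun x => x ++ r),
        t.length = L := by
      intro t ht
      obtain ⟨j, hj, rfl⟩ := List.getElem_of_mem ht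
      exact hL _ _ (hf.get (hf.length_eq ▸ hj) hj)
    have hrL : r.length < L := by
      obtain ⟨ys, y, e⟩ := (List.eq_nil_or_concat d.cutting).resolve_left h1
      have hy := List.length_pos_iff.2 (hcne y (by simp [e]))
      rw [e, List.concat_eq_append] at hlen
      cases ys with
      | nil =>
        have := hlen (l ++ y ++ r) (by
          simp [modifyLast_singleton])
        simp only [List.length_append] at this
        omega
      | cons x ys =>
        have := hlen (y ++ r) (by
          rw [List.cons_append, List.modifyHead_cons, ← List.cons_append,
            List.modifyLast_concat]
          simp)
        simp only [List.length_append] at this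
        omega
    have hlL : l.length < L := by
      obtain ⟨y, ys, e⟩ := List.exists_cons_of_ne_nil h1
      have hy := List.length_pos_iff.2 (hcne y (by simp [e]))
      rw [e, List.modifyHead_cons] at hlen
      rcases List.eq_nil_or_concat ys with rfl | ⟨ys, x, rfl⟩
      · have := hlen (l ++ y ++ r) (by
          simp [modifyLast_singleton])
        simp only [List.length_append] at this
        omega
      · have := hlen (l ++ y) (by
          rw [List.concat_eq_append, ← List.cons_append, List.modifyLast_concat]
          simp)
        simp only [List.length_append] at this
        omega
    -- All pieces are non-empty, so the padding on either side is shorter than `L`; being of length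
    -- divisible by `L`, it is empty.
    have hl0 : l = [] := by
      rw [← List.length_eq_zero_iff]
      exact Nat.eq_zero_of_dvd_of_lt (hl.trans hl'.symm ▸ hdvd) hlL
    have hr0 : r = [] := by
      rw [← List.length_eq_zero_iff]
      refine Nat.eq_zero_of_dvd_of_lt ?_ hrL
      have := length_of_mem_onWord hL hm
      rw [List.length_append, List.length_append, hwl, hl0, List.length_nil, Nat.zero_add] at this
      exact (Nat.dvd_add_right (Dvd.intro_left _ rfl)).1 (this ▸ Dvd.intro_left _ rfl)
    subst hl0 hr0
    refine ⟨hl.symm, ?_, hcf⟩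
    have e1 : (d.cutting.modifyHead (fun x => [] ++ x)) = d.cutting := by
      cases d.cutting <;> simp
    have e2 : (d.cutting.modifyLast (fun x => x ++ [])) = d.cutting := by
      obtain ⟨ys, y, e⟩ := (List.eq_nil_or_concat d.cutting).resolve_left h1
      rw [e, List.concat_eq_append, List.modifyLast_concat]
      simp
    rwa [e1, e2] at hf
  have huniq : ∀ d d', ϑ.IsDecomp w d → ϑ.IsDecomp w d' → d = d' := by
    intro d d' h1 h2
    obtain ⟨ho, hf, hfl⟩ := key d h1
    obtain ⟨ho', hf', hfl'⟩ := key d' h2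
    refine InflDecomp.ext (ho.trans ho'.symm) ?_
    have hroot : d.root = d'.root :=
      onWord_injective hL hd ⟨_, hf, hfl⟩ ⟨_, hf', hfl'⟩
    have hcut : d.cutting = d'.cutting := by
      rw [← hroot] at hf'
      exact eq_of_flatten_eq hL hf hf' (hfl.trans hfl'.symm)
    have hz : ∀ e : InflDecomp A, e.tiles = e.cutting.zip e.root := by
      intro e
      simp [InflDecomp.cutting, InflDecomp.root, List.zip_map', List.map_id']
    rw [hz d, hz d', hroot, hcut]
  obtain ⟨d, h1, -, h3⟩ := exists_isDecomp (l := []) (r := []) hL hR (by simpa using hw) hne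
    hpos hpos
  exact ⟨d, h1, h3, fun d' h' => huniq d' d h' h1⟩

end RandomSubst

namespace RandomSubst

variable {A : Type*} {ϑ : RandomSubst A} {L : ℕ}

/-! ### Words that fix the cutting points of all levels -/

/-- `u ∈ ϑ^p(y)` is obtained by `p` successive realisations, the results of which all
contain `z`. -/
def ChainContaining (ϑ : RandomSubst A) (z : List A) : ℕ → List A → List A → Prop
  | 0, y, u => u = y
  | p + 1, y, u => ∃ w, ChainContaining ϑ z p y w ∧ u ∈ ϑ.onWord w ∧ z <:+: u

theorem ChainContaining.mem_onWord {z : List A} {p : ℕ} {y u : List A}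
    (h : ϑ.ChainContaining z p y u) : u ∈ (ϑ.pow p).onWord y := by
  induction p generalizing u with
  | zero => exact mem_onWord_pow_zero.2 h
  | succ p ih =>
    obtain ⟨w, hw, hu, -⟩ := h
    exact mem_onWord_pow_succ.2 ⟨w, ih hw, hu⟩

theorem ChainContaining.append {z : List A} {p : ℕ} {y u f g : List A}
    (h : ϑ.ChainContaining z p y u) (hg : g ∈ (ϑ.pow p).onWord f) :
    ϑ.ChainContaining z p (y ++ f) (u ++ g) := by
  induction p generalizing u g with
  | zero =>
    rw [mem_onWord_pow_zero] at hg
    rw [ChainContaining] at h ⊢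
    rw [h, hg]
  | succ p ih =>
    obtain ⟨w, hw, hu, hz⟩ := h
    obtain ⟨x, hx, hg⟩ := mem_onWord_pow_succ.1 hg
    exact ⟨w ++ x, ih hw hx, append_mem_onWord hu hg,
      hz.trans (List.prefix_append u g).isInfix⟩

/-- Each letter of `b` takes care of one step: it supplies the occurrence of `z` in the result of
that step. Thus `y` has length linear in the number of steps. -/
theorem exists_chainContaining {z : List A} {q : ℕ}
    (hq : ∀ s, q ≤ s → ∀ b, ∃ w ∈ (ϑ.pow s).img b, z <:+: w) (b : List A) :
    ∃ y ∈ (ϑ.pow q).onWord b, ∃ u, ϑ.ChainContaining z b.length y u := by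
  induction b using List.reverseRecOn with
  | nil => exact ⟨[], mem_onWord_nil.2 rfl, [], rfl⟩
  | append_singleton b d ih =>
    obtain ⟨y, hy, u, hu⟩ := ih
    -- The first `q` steps give the new part `f` of `y`, the next `b.length` steps run beside the
    -- old chain, and the last one exhibits `z`.
    obtain ⟨h, hh, hz⟩ := hq (q + b.length + 1) (by omega) d
    obtain ⟨g, hg, hh⟩ := mem_pow_succ_img.1 hh
    obtain ⟨f, hf, hg⟩ := mem_pow_add_img.1 hg
    obtain ⟨v, hv⟩ := ϑ.onWord_nonempty u
    refine ⟨y ++ f, append_mem_onWord hy (mem_onWord_singleton.2 hf), v ++ h, ?_⟩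
    rw [List.length_append, List.length_singleton]
    exact ⟨u ++ g, hu.append hg, append_mem_onWord hv hh,
      hz.trans (List.suffix_append v h).isInfix⟩

theorem ChainContaining.dvd_length (hL : ∀ a, ∀ u ∈ ϑ.img a, u.length = L) (hpos : 0 < L)
    (hd : ϑ.DisjointImages) {z : List A}
    (hz : ∀ R R' l l' r r', ϑ.Legal R → ϑ.Legal R' → l ++ z ++ r ∈ ϑ.onWord R →
      l' ++ z ++ r' ∈ ϑ.onWord R' → l.length % L = l'.length % L)
    {p : ℕ} {y u : List A} (hy : ϑ.Legal y) (hu : ϑ.ChainContaining z p y u)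
    {R l r : List A} (hR : ϑ.Legal R) (h : l ++ u ++ r ∈ (ϑ.pow p).onWord R) :
    L ^ p ∣ l.length := by
  induction p generalizing u l r with
  | zero => simp
  | succ p ih =>
    obtain ⟨g, hg, hug, i, j, hzu⟩ := hu
    obtain ⟨w, hw, hlur⟩ := mem_onWord_pow_succ.1 h
    have hgl : ϑ.Legal g := hy.onWord_pow hg.mem_onWord
    have hwl : ϑ.Legal w := hR.onWord_pow hw
    have hmod : (l ++ i).length % L = i.length % L := by
      refine hz w g (l ++ i) i (j ++ r) j hwl hgl ?_ ?_
      · rw [← hzu] at hlur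
        simpa using hlur
      · rwa [hzu]
    have hdvd : L ∣ l.length := by
      rw [List.length_append] at hmod
      have : l.length + i.length ≡ 0 + i.length [MOD L] := by simpa [Nat.ModEq] using hmod
      exact (Nat.modEq_zero_iff_dvd).1 (Nat.ModEq.add_right_cancel' _ this)
    obtain ⟨k, hk⟩ := exists_eq_mul_left_of_dvd hdvd
    rw [List.append_assoc] at hlur
    obtain ⟨hl1, hl2⟩ := onWord_split hL hpos hlur hk
    obtain ⟨hl3, hl4⟩ := onWord_split hL hpos hl2 (length_of_mem_onWord hL hug)
    -- The occurrence of `u` is aligned with the cuts of `w`, so the part of `w` above it is `g`, to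
    -- which the induction hypothesis applies.
    have e := onWord_injective hL hd hl3 hug
    have hw' : w.take k ++ g ++ (w.drop k).drop g.length = w := by
      nth_rw 1 [← e]
      rw [List.append_assoc, List.take_append_drop, List.take_append_drop]
    have := ih hg (l := w.take k) (r := (w.drop k).drop g.length) (by rwa [hw'])
    rw [length_of_mem_onWord hL hl1, pow_succ]
    exact Nat.mul_dvd_mul_right this L

/-! ### Counting realisations -/

/-- Every `b` in `r` offers an independent choice between `g` and `g'`; equal lengths keep the
results distinct. -/
theorem exists_finset_onWord [DecidableEq A] (hL : ∀ a, ∀ u ∈ ϑ.img a, u.length = L) {b : A}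
    {g g' : List A} (hg : g ∈ ϑ.img b) (hg' : g' ∈ ϑ.img b) (hgg : g ≠ g') (r : List A) :
    ∃ V : Finset (List A), 2 ^ r.count b ≤ V.card ∧ ∀ v ∈ V, v ∈ ϑ.onWord r := by
  induction r with
  | nil => exact ⟨{[]}, by simp, by simp [mem_onWord_nil]⟩
  | cons c r ih =>
    obtain ⟨V, hV, hV'⟩ := ih
    by_cases hcb : c = b
    · subst hcb
      refine ⟨V.image (g ++ ·) ∪ V.image (g' ++ ·), ?_, ?_⟩
      · rw [Finset.card_union_of_disjoint, Finset.card_image_of_injective _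
          (List.append_right_injective g), Finset.card_image_of_injective _
          (List.append_right_injective g'), List.count_cons_self, pow_succ]
        · omega
        · rw [Finset.disjoint_left]
          intro x hx hx'
          obtain ⟨v, -, rfl⟩ := Finset.mem_image.1 hx
          obtain ⟨v', -, e⟩ := Finset.mem_image.1 hx'
          exact hgg (List.append_inj e (by rw [hL _ _ hg, hL _ _ hg'])).1.symm
      · intro v hv
        rw [Finset.mem_union, Finset.mem_image, Finset.mem_image] at hv
        rcases hv with ⟨v, hv, rfl⟩ | ⟨v, hv, rfl⟩
        · exact mem_onWord_cons.2 ⟨_, hg, _, hV' _ hv, rfl⟩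
        · exact mem_onWord_cons.2 ⟨_, hg', _, hV' _ hv, rfl⟩
    · obtain ⟨t, ht⟩ := ϑ.nonempty c
      refine ⟨V.image (t ++ ·), ?_, ?_⟩
      · rwa [Finset.card_image_of_injective _ (List.append_right_injective t),
          List.count_cons_of_ne hcb]
      · intro v hv
        rw [Finset.mem_image] at hv
        obtain ⟨v, hv, rfl⟩ := hv
        exact mem_onWord_cons.2 ⟨_, ht, _, hV' _ hv, rfl⟩

theorem length_le_count_flatMap [DecidableEq A] {β : A → List A} {b : A} (hβ : ∀ a, b ∈ β a)
    (v : List A) : v.length ≤ (v.flatMap β).count b := by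
  induction v with
  | nil => simp
  | cons a v ih =>
    have := List.count_pos_iff.2 (hβ a)
    rw [List.flatMap_cons, List.count_append, List.length_cons]
    omega

theorem legal_singleton (a : A) : ϑ.Legal [a] :=
  ⟨by simp, a, 0, [a], rfl, List.infix_rfl⟩

/-- After `j` steps there are `L ^ j` letters, after `s` more at least as many letters `b`, and one
last step gives at least `2 ^ L ^ j` words, against a bound linear in the exponent. -/
theorem exists_pow_many_images [DecidableEq A] (hL : ∀ a, ∀ u ∈ ϑ.img a, u.length = L)
    (h2 : 2 ≤ L) (hprim : ϑ.Primitive) {b : A} {g g' : List A} (hg : g ∈ ϑ.img b)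
    (hg' : g' ∈ ϑ.img b) (hgg : g ≠ g') (C : ℕ) :
    ∃ p, 1 ≤ p ∧ ∀ a, ∃ V : Finset (List A), p * C + 2 < V.card ∧
      ∀ v ∈ V, v ∈ (ϑ.pow p).img a := by
  obtain ⟨s, hs⟩ := hprim.exists_infix (legal_singleton b)
  choose β hβ hbβ using hs s le_rfl
  have hbβ' : ∀ a, b ∈ β a := fun a => (hbβ a).subset (by simp)
  -- Large enough that `(j + s + 1) * C + 2 < 2 * j * j`.
  set j := s + 1 + C + 3 with hj
  refine ⟨j + s + 1, by omega, fun a => ?_⟩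
  obtain ⟨w, hw⟩ := (ϑ.pow j).nonempty a
  obtain ⟨V, hV, hV'⟩ := exists_finset_onWord hL hg hg' hgg (w.flatMap β)
  refine ⟨V, ?_, fun v hv => mem_pow_succ_img.2
    ⟨_, mem_pow_add_img.2 ⟨w, hw, flatMap_mem_onWord hβ w⟩, hV' v hv⟩⟩
  refine lt_of_lt_of_le ?_ hV
  have hc := length_le_count_flatMap hbβ' w
  rw [length_of_mem_pow_img hL _ _ _ hw] at hc
  have h2j : 2 * j ≤ 2 ^ j := by
    obtain ⟨i, hi⟩ : ∃ i, j = i + 1 := ⟨s + 1 + C + 2, by omega⟩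
    have : i < 2 ^ i := Nat.lt_two_pow_self
    rw [hi, pow_succ]
    omega
  have hlt : j < 2 ^ j := Nat.lt_two_pow_self
  calc (j + s + 1) * C + 2 < (2 * j) * j := by rw [hj]; nlinarith
    _ ≤ 2 ^ j * 2 ^ j := Nat.mul_le_mul h2j hlt.le
    _ = 2 ^ (2 * j) := by rw [← pow_add, two_mul]
    _ ≤ 2 ^ (w.flatMap β).count b := Nat.pow_le_pow_right (by omega)
        ((h2j.trans (Nat.pow_le_pow_left h2 j)).trans hc)

/-! ### Legal extensions -/

/-- On a legal two-letter word, a common large power can show `a` over the first letter and `y` over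
the second. -/
theorem exists_legal_cons_append (hL : ∀ a, ∀ u ∈ ϑ.img a, u.length = L) (h2 : 2 ≤ L)
    (hprim : ϑ.Primitive) (a : A) {y : List A} (hy : ϑ.Legal y) :
    ∃ e, ϑ.Legal (a :: e ++ y) := by
  obtain ⟨s, hs⟩ := hprim.exists_infix (legal_singleton a)
  obtain ⟨s', hs'⟩ := hprim.exists_infix hy
  obtain ⟨B, hB, hBl⟩ := exists_legal_length hL h2 a (n := 2) (by omega)
  match B, hBl with
  | [b, c], _ =>
    obtain ⟨w, hw, l, r, rfl⟩ := hs (max s s') (le_max_left _ _) b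
    obtain ⟨w', hw', l', r', rfl⟩ := hs' (max s s') (le_max_right _ _) c
    refine ⟨r ++ l', (hB.onWord_pow (p := max s s') (mem_onWord_cons.2
      ⟨_, hw, _, mem_onWord_singleton.2 hw', rfl⟩)).infix (by simp) ⟨l, r', by simp⟩⟩

/-- Realise a legal word of length `k + 3` so that `x` appears over every letter: three letters show
the required copies of `x`, the other `k` supply letters `a`. -/
theorem exists_legal_return [DecidableEq A] (hL : ∀ a, ∀ u ∈ ϑ.img a, u.length = L)
    (h2 : 2 ≤ L) (hprim : ϑ.Primitive) {x : List A} (hx : ϑ.Legal x) {a : A} (ha : a ∈ x)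
    (k : ℕ) : ∃ r r', ϑ.Legal (x ++ (r ++ x ++ r') ++ x) ∧ k ≤ r'.count a := by
  obtain ⟨s, hs⟩ := hprim.exists_infix hx
  choose β hβ hxβ using hs s le_rfl
  obtain ⟨B, hB, hBl⟩ := exists_legal_length hL h2 a (n := k + 3) (by omega)
  obtain ⟨b, B, rfl⟩ := List.exists_cons_of_length_pos (l := B) (by omega)
  obtain ⟨c, B, rfl⟩ := List.exists_cons_of_length_pos (l := B) (by simp at hBl; omega)
  obtain ⟨B, d, rfl⟩ := (List.eq_nil_or_concat B).resolve_left (by rintro rfl; simp at hBl)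
  have hlen : B.length = k := by simpa using hBl
  obtain ⟨l₁, r₁, e₁⟩ := hxβ b
  obtain ⟨l₂, r₂, e₂⟩ := hxβ c
  obtain ⟨l₃, r₃, e₃⟩ := hxβ d
  have hleg := hB.onWord_pow (flatMap_mem_onWord hβ _)
  refine ⟨r₁ ++ l₂, r₂ ++ B.flatMap β ++ l₃, hleg.infix (by simp [hx.1])
    ⟨l₁, r₃, by simp [← e₁, ← e₂, ← e₃]⟩, ?_⟩
  have := length_le_count_flatMap (fun c => (hxβ c).subset ha) B
  simp only [List.count_append]
  omega

theorem exists_legal_margins (hL : ∀ a, ∀ u ∈ ϑ.img a, u.length = L) (h2 : 2 ≤ L)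
    (hprim : ϑ.Primitive) {z : List A} (hz : ϑ.Legal z) (N : ℕ) :
    ∃ l r : List A, l.length = N ∧ r.length = N ∧ ϑ.Legal (l ++ z ++ r) := by
  classical
  obtain ⟨a, ha⟩ := List.exists_mem_of_ne_nil z hz.1
  obtain ⟨r, r', h, hk⟩ := exists_legal_return hL h2 hprim hz ha N
  obtain ⟨s, s', h', -⟩ := exists_legal_return hL h2 hprim h (a := a) (by simp [ha]) 0
  have hr : N ≤ r'.length := hk.trans List.count_le_length
  -- In the doubly iterated return word, the margins are taken around the last `z` of the first copy
  -- of `z ++ (r ++ z ++ r') ++ z`.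
  refine ⟨r'.drop (r'.length - N),
    (s ++ (z ++ (r ++ z ++ r') ++ z) ++ s' ++ (z ++ (r ++ z ++ r') ++ z)).take N, ?_, ?_, ?_⟩
  · rw [List.length_drop]
    omega
  · rw [List.length_take]
    simp only [List.length_append]
    omega
  · refine h'.infix (by simp [hz.1]) ⟨z ++ r ++ z ++ r'.take (r'.length - N),
      (s ++ (z ++ (r ++ z ++ r') ++ z) ++ s' ++ (z ++ (r ++ z ++ r') ++ z)).drop N, ?_⟩
    have e₁ := List.take_append_drop (r'.length - N) r'
    have e₂ := List.take_append_drop N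
      (s ++ (z ++ (r ++ z ++ r') ++ z) ++ s' ++ (z ++ (r ++ z ++ r') ++ z))
    generalize (s ++ (z ++ (r ++ z ++ r') ++ z) ++ s' ++ (z ++ (r ++ z ++ r') ++ z)).take N = t
      at *
    generalize (s ++ (z ++ (r ++ z ++ r') ++ z) ++ s' ++ (z ++ (r ++ z ++ r') ++ z)).drop N = t'
      at *
    calc _ = z ++ r ++ z ++ (r'.take (r'.length - N) ++ r'.drop (r'.length - N)) ++ z
          ++ (t ++ t') := by simp only [List.append_assoc]
      _ = _ := by
        rw [e₁, e₂]
        simp only [List.append_assoc]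

end RandomSubst

/-! ### Counting occurrences by blocks, and the construction of `u` and `V` -/

namespace RandomSubst

variable {A : Type*} {ϑ : RandomSubst A} {L : ℕ}

theorem exists_two_images [DecidableEq A] (hdeg : ¬ ϑ.Degenerate) :
    ∃ b, ∃ g ∈ ϑ.img b, ∃ g' ∈ ϑ.img b, g ≠ g' := by
  by_contra! h
  apply hdeg
  intro a
  obtain ⟨u, hu⟩ := ϑ.nonempty a
  rw [Set.ncard_eq_one]
  exact ⟨u, Set.eq_singleton_iff_unique_mem.2 ⟨hu, fun v hv => h a v hv u hu⟩⟩

/-- Distinct one-letter words have distinct abelianisations, which rules out `L = 1`. -/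
theorem Compatible.two_le [DecidableEq A] (hcomp : ϑ.Compatible)
    (hL : ∀ a, ∀ u ∈ ϑ.img a, u.length = L) {b : A} {g g' : List A} (hg : g ∈ ϑ.img b)
    (hg' : g' ∈ ϑ.img b) (hgg : g ≠ g') : 2 ≤ L := by
  have h1 := hL _ _ hg
  have h2 := hL _ _ hg'
  by_contra! h
  interval_cases L
  · exact ϑ.ne_nil _ _ hg (List.length_eq_zero_iff.1 h1)
  · obtain ⟨x, rfl⟩ := List.length_eq_one_iff.1 h1
    obtain ⟨y, rfl⟩ := List.length_eq_one_iff.1 h2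
    have := hcomp b _ hg _ hg' x
    by_cases hxy : y = x
    · exact hgg (by rw [hxy])
    · simp [hxy] at this

/-- Let `u` and `v` be concatenations of words of length `L`, where `t` occurs only as the first
of those of `u`. If `u` occurs in `uvu` at multiples of `L` only, then it occurs exactly twice. -/
theorem occurrences_eq_two [DecidableEq A] (hpos : 0 < L) {t : List A} {P Q : List (List A)}
    {u v : List A} (hu : u = t ++ P.flatten) (hv : v = Q.flatten) (htL : t.length = L)
    (hP : ∀ x ∈ P, x.length = L) (hQ : ∀ x ∈ Q, x.length = L) (htP : t ∉ P) (htQ : t ∉ Q)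
    (hdvd : ∀ l r, l ++ u ++ r = u ++ v ++ u → L ∣ l.length) :
    occurrences u (u ++ v ++ u) = 2 := by
  have hfl : ∀ T : List (List A), (∀ x ∈ T, x.length = L) → T.flatten.length = T.length * L := by
    intro T hT
    induction T with
    | nil => simp
    | cons x T ih =>
      simp [hT x (by simp), ih (fun y hy => hT y (by simp [hy]))]
      ring
  have hdrop : ∀ (T : List (List A)), (∀ x ∈ T, x.length = L) → ∀ j,
      T.flatten.drop (j * L) = (T.drop j).flatten := by
    intro T hT j
    conv_lhs => rw [← List.take_append_drop j T, List.flatten_append]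
    by_cases hj : j ≤ T.length
    · rw [List.drop_left']
      rw [hfl _ (fun x hx => hT x (List.mem_of_mem_take hx)), List.length_take,
        min_eq_left hj]
    · rw [List.drop_of_length_le (i := j) (l := T) (by omega)]
      rw [List.flatten_nil, List.append_nil, List.drop_of_length_le]
      rw [hfl _ (fun x hx => hT x (List.mem_of_mem_take hx)), List.length_take]
      exact Nat.mul_le_mul_right _ (min_le_left _ _)
  set T : List (List A) := (t :: (P ++ Q)) ++ t :: P with hT
  have hTf : u ++ v ++ u = T.flatten := by simp [hT, hu, hv]
  have hTL : ∀ x ∈ T, x.length = L := by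
    intro x hx
    simp only [hT, List.mem_append, List.mem_cons] at hx
    rcases hx with (rfl | h | h) | rfl | h
    exacts [htL, hP _ h, hQ _ h, htL, hP _ h]
  have hul : 0 < u.length := by rw [hu, List.length_append]; omega
  have hset : (Finset.range ((u ++ v ++ u).length + 1)).filter
      (fun i => u <+: (u ++ v ++ u).drop i) = {0, (u ++ v).length} := by
    ext i
    rw [Finset.mem_filter, Finset.mem_range, Finset.mem_insert, Finset.mem_singleton]
    constructor
    · rintro ⟨hi, r, hr⟩
      have hlen : ((u ++ v ++ u).take i).length = i := by
        rw [List.length_take]; omega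
      obtain ⟨j, hj⟩ := exists_eq_mul_left_of_dvd (hdvd ((u ++ v ++ u).take i) r (by
        rw [List.append_assoc, hr, List.take_append_drop]))
      rw [hlen] at hj
      subst hj
      rw [hTf, hdrop T hTL] at hr
      cases hD : T.drop j with
      | nil =>
        rw [hD, List.flatten_nil, List.append_eq_nil_iff] at hr
        simp [hr.1] at hul
      | cons x D =>
        -- An occurrence at a multiple of `L` begins with a full block, which must be `t`; only the
        -- blocks `0` and `P.length + Q.length + 1` of `T` are `t`.
        have hx : x = t := by
          rw [hD, hu, List.flatten_cons, List.append_assoc] at hr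
          refine ((List.append_inj hr ?_).1).symm
          rw [htL, hTL x (List.mem_of_mem_drop (i := j) (by rw [hD]; simp))]
        subst hx
        have hget : T[j]? = some x := by
          rw [← List.head?_drop, hD]; rfl
        have hlv : (u ++ v).length = (P.length + Q.length + 1) * L := by
          rw [hu, hv, List.length_append, List.length_append, hfl _ hP, hfl _ hQ, htL]
          ring
        rcases lt_trichotomy j (P.length + Q.length + 1) with hlt | rfl | hgt
        · left
          cases j with
          | zero => simp
          | succ j =>
            exfalso
            rw [hT, List.getElem?_append_left (by simp; omega), List.getElem?_cons_succ] at hget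
            rcases List.mem_append.1 (List.mem_of_getElem? hget) with h | h
            exacts [htP h, htQ h]
        · right
          rw [hlv]
        · exfalso
          obtain ⟨i, rfl⟩ := Nat.exists_eq_add_of_lt hgt
          rw [hT, List.getElem?_append_right (by simp; omega)] at hget
          rw [show P.length + Q.length + 1 + i + 1 - (x :: (P ++ Q)).length = i + 1 by
            simp; omega, List.getElem?_cons_succ] at hget
          exact htP (List.mem_of_getElem? hget)
    · rintro (rfl | rfl)
      · exact ⟨by omega, by simp [List.append_assoc]⟩
      · refine ⟨by simp only [List.length_append]; omega, ?_⟩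
        rw [List.drop_left]
  rw [occurrences, hset, Finset.card_pair]
  simp only [List.length_append]
  omega

end RandomSubst

open RandomSubst in
theorem lemma5 {A : Type*} [Fintype A] [DecidableEq A] (ϑ : RandomSubst A)
    (hdeg : ¬ ϑ.Degenerate) (hlen : ϑ.ConstantLength) (hprim : ϑ.Primitive)
    (hcomp : ϑ.Compatible) (hdisj : ϑ.DisjointImages)
    (hrec : ∃ z : List A, ϑ.RecognisableWord z) :
    ∃ p : ℕ, 1 ≤ p ∧ ∃ u : List A, (ϑ.pow p).RecognisableWord u ∧
      ∃ n : ℕ → ℕ, StrictMono n ∧ ∀ k : ℕ, 1 ≤ k →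
        ∃ V : Finset (List A), k ≤ V.card ∧
          (∀ v ∈ V, v.length = n k ∧ occurrences u (u ++ v ++ u) = 2 ∧
            ϑ.Legal (u ++ v ++ u)) ∧
          ∃ r s : List A, ∀ v ∈ V, (ϑ.pow p).HasUniqueRoot v r ∧
            (ϑ.pow p).HasUniqueRoot (u ++ v ++ u) s := by
  obtain ⟨L, hL⟩ := hlen
  obtain ⟨b, g, hg, g', hg', hgg⟩ := exists_two_images hdeg
  have h2 := hcomp.two_le hL hg hg' hgg
  have hpos : 0 < L := by omega
  obtain ⟨z₀, hz₀, N, hN⟩ := hrec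
  obtain ⟨l, r, hl, hr, hz⟩ := exists_legal_margins hL h2 hprim hz₀ N
  have hmod := fun R R' l' l'' r' r'' =>
    mod_eq_of_induced_eq hL hpos (z := l ++ z₀ ++ r) (N := N) (m := z₀.length)
      (by have := List.length_pos_iff.2 hz₀.1; simp only [List.length_append]; omega)
      (hN l r hl hr hz) (R := R) (R' := R') (l := l') (l' := l'') (r := r') (r' := r'')
  generalize l ++ z₀ ++ r = z at hz hmod
  obtain ⟨q, hq⟩ := hprim.exists_infix hz
  -- `p * L ^ q` will be the number of blocks of `U`; the surplus of more than two leaves room for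
  -- `t`, `t'` and `t''`.
  obtain ⟨p, hp, hmany⟩ := exists_pow_many_images hL h2 hprim hg hg' hgg (L ^ q)
  refine ⟨p, hp, ?_⟩
  obtain ⟨B, hB, hBl⟩ := exists_legal_length hL h2 b hp
  obtain ⟨y, hyB, U, hU⟩ := exists_chainContaining hq B
  rw [hBl] at hU
  have hy : ϑ.Legal y := hB.onWord_pow hyB
  have hyl : y.length = p * L ^ q := by
    rw [length_of_mem_onWord (length_of_mem_pow_img hL q) hyB, hBl]
  have hdvd := fun R l r => hU.dvd_length hL hpos hdisj hmod hy (R := R) (l := l) (r := r)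
  have hUy := hU.mem_onWord
  set Θ := ϑ.pow p with hΘ
  set M := L ^ p with hM
  have hMpos : 0 < M := Nat.pow_pos hpos
  have hΘL : ∀ a, ∀ u ∈ Θ.img a, u.length = M := length_of_mem_pow_img hL p
  have hΘd : Θ.DisjointImages := hdisj.pow hL p
  have hroot : ∀ R i j, ϑ.Legal R → i ++ U ++ j ∈ Θ.onWord R → M ∣ i.length →
      Θ.HasUniqueRoot (i ++ U ++ j) R := by
    intro R i j hR hR' hi
    refine hasUniqueRoot_of_dvd hΘL hMpos hΘd (hR.pow hprim hp) hR' fun R' l r hR' hm => ?_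
    have := hdvd R' (l ++ i) (j ++ r) hR'.of_pow (by simpa using hm)
    rw [List.length_append] at this
    exact (Nat.dvd_add_left hi).1 this
  obtain ⟨TU, hTU, hTUf⟩ := hUy
  obtain ⟨W, hW, hWb⟩ := hmany b
  have hTUl : TU.length = p * L ^ q := by rw [← hTU.length_eq, hyl]
  obtain ⟨t, ht, htU, t', ht', t'', ht'', h01, h02, h12⟩ : ∃ t ∈ Θ.img b, t ∉ TU ∧
      ∃ t' ∈ Θ.img b, ∃ t'' ∈ Θ.img b, t ≠ t' ∧ t ≠ t'' ∧ t' ≠ t'' := by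
    have h3 : 2 < (W \ TU.toFinset).card := by
      have := Finset.le_card_sdiff TU.toFinset W
      have := List.toFinset_card_le TU
      omega
    obtain ⟨t, ht, t', ht', t'', ht'', h⟩ := Finset.two_lt_card.1 h3
    rw [Finset.mem_sdiff, List.mem_toFinset] at ht ht' ht''
    exact ⟨t, hWb t ht.1, ht.2, t', hWb t' ht'.1, t'', hWb t'' ht''.1, h⟩
  -- `Θ` without the marker `t`. Images stay non-empty: `t'` remains over `b`, and by disjoint
  -- images no other letter loses a word.
  let ψ : RandomSubst A :=
    { img := fun c => Θ.img c \ {t}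
      finite := fun c => (Θ.finite c).sdiff
      nonempty := fun c => by
        by_cases hc : c = b
        · subst hc
          exact ⟨t', ht', h01.symm⟩
        · obtain ⟨s, hs⟩ := Θ.nonempty c
          refine ⟨s, hs, ?_⟩
          rintro rfl
          exact hc (hΘd c b ⟨s, hs, ht⟩)
      ne_nil := fun c s hs => Θ.ne_nil c s hs.1 }
  have hψL : ∀ a, ∀ u ∈ ψ.img a, u.length = M := fun a u hu => hΘL a u hu.1
  have hψΘ : ∀ {R w}, w ∈ ψ.onWord R → w ∈ Θ.onWord R := by
    rintro R w ⟨T, hT, rfl⟩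
    exact ⟨T, hT.imp fun _ _ h => h.1, rfl⟩
  have hψt : ∀ {R w}, w ∈ ψ.onWord R →
      ∃ T : List (List A), (∀ x ∈ T, x.length = M) ∧ t ∉ T ∧ w = T.flatten := by
    rintro R w ⟨T, hT, rfl⟩
    have : ∀ x ∈ T, ∃ c, x ∈ ψ.img c := by
      intro x hx
      obtain ⟨j, hj, rfl⟩ := List.getElem_of_mem hx
      exact ⟨_, hT.get (hT.length_eq ▸ hj) hj⟩
    refine ⟨T, fun x hx => ?_, fun hx => ?_, rfl⟩
    · obtain ⟨c, hc⟩ := this x hx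
      exact hψL c x hc
    · obtain ⟨c, hc⟩ := this t hx
      exact hc.2 rfl
  have hUψ : U ∈ ψ.onWord y := by
    refine ⟨TU, ?_, hTUf⟩
    rw [List.forall₂_iff_get] at hTU ⊢
    refine ⟨hTU.1, fun i h h' => ⟨hTU.2 i h h', ?_⟩⟩
    intro e
    exact htU (by rw [← Set.mem_singleton_iff.1 e]; exact List.get_mem _ _)
  obtain ⟨e, he⟩ := exists_legal_cons_append hL h2 hprim b hy
  obtain ⟨E, hE⟩ := ψ.onWord_nonempty e
  have hEU : E ++ U ∈ ψ.onWord (e ++ y) := append_mem_onWord hE hUψ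
  have htEU : t ++ E ++ U ∈ Θ.onWord (b :: e ++ y) := by
    rw [List.append_assoc]
    exact mem_onWord_cons.2 ⟨t, ht, _, hψΘ hEU, rfl⟩
  have htE : M ∣ (t ++ E).length := by
    rw [List.length_append, hΘL _ _ ht, length_of_mem_onWord hψL hE]
    exact (Nat.dvd_add_right (dvd_refl _)).2 (Dvd.intro_left _ rfl)
  have huroot : Θ.HasUniqueRoot (t ++ E ++ U) (b :: e ++ y) := by
    simpa using hroot _ (t ++ E) [] he (by simpa using htEU) htE
  set u := t ++ E ++ U with hu
  -- As `u` has only one decomposition, no margin is needed.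
  refine ⟨u, ⟨(he.onWord_pow htEU).pow hprim hp, 0, ?_⟩, ?_⟩
  · intro l r hl hr _ d d' hd hd'
    rw [List.length_eq_zero_iff.1 hl, List.length_eq_zero_iff.1 hr, List.nil_append,
      List.append_nil] at hd hd'
    obtain ⟨d₀, -, -, hd₀⟩ := huroot
    rw [hd₀ d hd, hd₀ d' hd']
  -- For each `k`, suitable lengths occur beyond every bound, so a strictly increasing choice
  -- exists.
  obtain ⟨n, hn, hn'⟩ := Filter.extraction_forall_of_frequently
    (P := fun k n => ∃ V : Finset (List A), k ≤ V.card ∧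
          (∀ v ∈ V, v.length = n ∧ occurrences u (u ++ v ++ u) = 2 ∧
            ϑ.Legal (u ++ v ++ u)) ∧
          ∃ r s : List A, ∀ v ∈ V, Θ.HasUniqueRoot v r ∧
            Θ.HasUniqueRoot (u ++ v ++ u) s) (by
    intro k
    rw [Filter.frequently_atTop]
    intro m
    -- The count of `b` in `r'` serves twice: `k` for the number of words `v`, `m` for their length.
    obtain ⟨r, r', hleg, hk⟩ := exists_legal_return hL h2 hprim he (a := b) (by simp) (max k m)
    set R := r ++ (b :: e ++ y) ++ r' with hR
    have hRleg : ϑ.Legal R := hleg.infix (by simp [hR]) (List.infix_append _ _ _)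
    obtain ⟨V₀, hV₀, hV₀'⟩ := exists_finset_onWord hψL (show t' ∈ ψ.img b from ⟨ht', h01.symm⟩)
      (show t'' ∈ ψ.img b from ⟨ht'', h02.symm⟩) h12 r'
    obtain ⟨v₁, hv₁⟩ := ψ.onWord_nonempty (r ++ b :: e)
    have hmem : ∀ v ∈ V₀, v₁ ++ U ++ v ∈ ψ.onWord R := by
      intro v hv
      have := append_mem_onWord (append_mem_onWord hv₁ hUψ) (hV₀' v hv)
      simpa [hR] using this
    refine ⟨R.length * M, ?_, V₀.image (v₁ ++ U ++ ·), ?_, ?_, R,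
      (b :: e ++ y) ++ R ++ (b :: e ++ y), ?_⟩
    · have h1 : r'.count b ≤ R.length := List.count_le_length.trans (by simp [hR]; omega)
      have h3 : R.length ≤ R.length * M := Nat.le_mul_of_pos_right _ hMpos
      have := le_max_right k m
      show m ≤ R.length * M
      omega
    · rw [Finset.card_image_of_injective _ (List.append_right_injective _)]
      have : r'.count b < 2 ^ r'.count b := Nat.lt_two_pow_self
      have := le_max_left k m
      omega
    · intro v hv
      rw [Finset.mem_image] at hv
      obtain ⟨v, hv, rfl⟩ := hv
      have hv' := hmem v hv
      generalize v₁ ++ U ++ v = v at *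
      have huvu := append_mem_onWord (append_mem_onWord htEU (hψΘ hv')) htEU
      refine ⟨length_of_mem_onWord hψL hv', ?_, hleg.onWord_pow huvu⟩
      obtain ⟨P, hP, htP, hPf⟩ := hψt hEU
      obtain ⟨Q, hQ, htQ, hQf⟩ := hψt hv'
      refine occurrences_eq_two hMpos (by rw [hu, ← hPf, List.append_assoc]) hQf
        (hΘL _ _ ht) hP hQ htP htQ fun i j hij => ?_
      -- The occurrence of `u` at `i` carries a copy of `U` at `i ++ (t ++ E)`, whose length is a
      -- multiple of `M`; so is that of `t ++ E`.
      have := hdvd _ (i ++ (t ++ E)) j hleg (by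
        rw [← hij, hu] at huvu
        simpa using huvu)
      rw [List.length_append] at this
      exact (Nat.dvd_add_left htE).1 this
    · intro v hv
      rw [Finset.mem_image] at hv
      obtain ⟨v, hv, rfl⟩ := hv
      have hv' := hmem v hv
      refine ⟨hroot R v₁ v hRleg (hψΘ hv') ?_, ?_⟩
      · rw [length_of_mem_onWord hψL hv₁]
        exact Dvd.intro_left _ rfl
      · have huvu := append_mem_onWord (append_mem_onWord htEU (hψΘ hv')) htEU
        have := hroot _ (t ++ E) (v₁ ++ U ++ v ++ u) hleg (by simpa [hu] using huvu) htE
        simpa [hu] using this)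
  exact ⟨n, hn, fun k _ => hn' k⟩
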